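/- Let $\mathcal{A}$ be a unital $C^*$-algebra and let $\mathcal{S}\subset\mathcal{A}^*$ be its state space, endowed with the weak$^*$ topology. For a state $\varphi\in\mathcal{S}$ let $(\pi_\varphi,\mathsf{H}_\varphi,\xi_\varphi)$ denote its GNS (cyclic) representation, and let $\pi_\varphi(\mathcal{A})'$ denote the commutant of $\pi_\varphi(\mathcal{A})$ in the bounded operators on $\mathsf{H}_\varphi$. A state $\rho$ is the barycenter of a regular Borel probability measure $\mu$ on $\mathcal{S}$ if $\rho(X)=\int_{\mathcal{S}}\varphi(X)\,\mu(d\varphi)$ for all $X\in\mathcal{A}$. Let $\rho_1,\rho_2\in\mathcal{S}$. Then the following are equivalent: 1. There exist regular Borel probability measures $\mu_1,\mu_2$ on $\mathcal{S}$ such that $\rho_1$ is the barycenter of $\mu_1$, $\rho_2$ is the barycenter of $\mu_2$, and $\mu_1\ll\mu_2$. 2. For every sequence $(X_n)_{n\in\mathbb{N}}$ in $\mathcal{A}$ such that $\lim_{m,n\to\infty}\rho_1\big((X_m-X_n)^*(X_m-X_n)\big)=0$ and $\lim_{n\to\infty}\rho_2(X_n^*X_n)=0$, we have $\lim_{n\to\infty}\rho_1(X_n^*X_n)=0$.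 3. There exists a positive self-adjoint (possibly unbounded) operator $T$ on $\mathsf{H}_{\rho_2}$, affiliated to $\pi_{\rho_2}(\mathcal{A})'$ and with $\xi_{\rho_2}$ in its domain, such that $\rho_1(X)=\langle T\xi_{\rho_2},\pi_{\rho_2}(X)\,T\xi_{\rho_2}\rangle$ for all $X\in\mathcal{A}$. (Here $T$ is affiliated to a von Neumann algebra $\mathfrak{M}$ if $UT=TU$ for every unitary $U$ in the commutant $\mathfrak{M}'$.) -/

import Mathlib

open MeasureTheory Filter Topology
open scoped ComplexOrder InnerProductSpace

namespace CStarState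

/-- The state space of a unital C⋆-algebra: the positive linear functionals with value `1` at the
unit, as a subset of the dual with the weak-⋆ topology. -/
def stateSpace (A : Type*) [CStarAlgebra A] [PartialOrder A] : Set (WeakDual ℂ A) :=
  {φ | (∀ a : A, 0 ≤ a → 0 ≤ φ a) ∧ φ 1 = 1}

/-- States, with the (subspace) weak-⋆ topology. -/
abbrev State (A : Type*) [CStarAlgebra A] [PartialOrder A] : Type _ :=
  stateSpace A

section Measures

variable {A : Type*} [CStarAlgebra A] [PartialOrder A]

/-- The Borel σ-algebra of the weak-⋆ topology. -/
noncomputable instance instMeasurableSpaceState : MeasurableSpace (State A) :=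
  borel (State A)

instance instBorelSpaceState : BorelSpace (State A) :=
  ⟨rfl⟩

/-- `ρ` is the barycenter of `μ`. For a finite measure `μ` the integrand is a bounded continuous
function of `φ`, so the integral is never a junk value. -/
def IsBarycenter (ρ : State A) (μ : Measure (State A)) : Prop :=
  ∀ X : A, ρ.1 X = ∫ φ : State A, φ.1 X ∂μ

/-- Absolute continuity of states: `ρ₁` and `ρ₂` are the barycenters of regular Borel probability
measures `μ₁ ≪ μ₂` on the state space. -/
def AbsolutelyContinuous (ρ₁ ρ₂ : State A) : Prop :=
  ∃ μ₁ μ₂ : Measure (State A),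
    IsProbabilityMeasure μ₁ ∧ μ₁.Regular ∧
    IsProbabilityMeasure μ₂ ∧ μ₂.Regular ∧
    IsBarycenter ρ₁ μ₁ ∧ IsBarycenter ρ₂ μ₂ ∧ μ₁ ≪ μ₂

/-- `ρ₁` is almost dominated ("presque dominée") by `ρ₂`. -/
def AlmostDominated (ρ₁ ρ₂ : State A) : Prop :=
  ∀ X : ℕ → A,
    Tendsto (fun p : ℕ × ℕ => ρ₁.1 (star (X p.1 - X p.2) * (X p.1 - X p.2))) atTop (𝓝 0) →
    Tendsto (fun n => ρ₂.1 (star (X n) * X n)) atTop (𝓝 0) →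
    Tendsto (fun n => ρ₁.1 (star (X n) * X n)) atTop (𝓝 0)

end Measures

section Operators

variable {H : Type*} [NormedAddCommGroup H] [InnerProductSpace ℂ H] [CompleteSpace H]

/-- The commutant of the range of a representation, as a von Neumann algebra. -/
noncomputable def repCommutant {A : Type*} [CStarAlgebra A] (π : A →⋆ₐ[ℂ] (H →L[ℂ] H)) :
    VonNeumannAlgebra H where
  toStarSubalgebra := StarSubalgebra.centralizer ℂ (Set.range π)
  centralizer_centralizer' :=
    Set.centralizer_centralizer_centralizer (Set.range π ∪ star (Set.range π))

/-- A (closed, densely defined) unbounded operator `T` is affiliated to the von Neumann algebra `M`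
if it commutes with every unitary `U` in the commutant of `M`, that is `U T ⊆ T U`
(applied to `U` and to its adjoint, this gives `U T = T U`). -/
def IsAffiliated (M : VonNeumannAlgebra H) (T : H →ₗ.[ℂ] H) : Prop :=
  ∀ U ∈ M.commutant, U ∈ unitary (H →L[ℂ] H) →
    ∀ x : T.domain, ∃ h : U (x : H) ∈ T.domain, T ⟨U (x : H), h⟩ = U (T x)

/-- Positivity of an unbounded operator. -/
def IsPositive (T : H →ₗ.[ℂ] H) : Prop :=
  ∀ x : T.domain, 0 ≤ ⟪(x : H), T x⟫_ℂ

end Operators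

section GNS

variable {A : Type*} [CStarAlgebra A] [PartialOrder A] [StarOrderedRing A]

/-- A state as a positive linear map. -/
noncomputable def toPositive (ρ : State A) : A →ₚ[ℂ] ℂ :=
  PositiveLinearMap.mk₀ (ρ.1 : A →L[ℂ] ℂ).toLinearMap ρ.2.1

/-- The Hilbert space of the GNS representation of `ρ`. -/
abbrev GNSSpace (ρ : State A) : Type _ :=
  (toPositive ρ).GNS

/-- The GNS representation of `ρ`. -/
noncomputable def gnsRep (ρ : State A) : A →⋆ₐ[ℂ] (GNSSpace ρ →L[ℂ] GNSSpace ρ) :=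
  (toPositive ρ).gnsStarAlgHom

/-- The cyclic vector of the GNS representation of `ρ`: the class of the unit. -/
noncomputable def gnsVector (ρ : State A) : GNSSpace ρ :=
  (((toPositive ρ).toPreGNS 1 : (toPositive ρ).PreGNS) : GNSSpace ρ)

/-- `ρ₁` is the vector functional of `T ξ`, for a positive self-adjoint operator `T` affiliated to
the commutant of the GNS representation of `ρ₂`, whose domain contains the cyclic vector `ξ`. -/
def HasAffiliatedDensity (ρ₁ ρ₂ : State A) : Prop :=
  ∃ T : GNSSpace ρ₂ →ₗ.[ℂ] GNSSpace ρ₂,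
    IsSelfAdjoint T ∧ IsPositive T ∧ IsAffiliated (repCommutant (gnsRep ρ₂)) T ∧
    ∃ hξ : gnsVector ρ₂ ∈ T.domain,
      ∀ X : A, ρ₁.1 X = ⟪T ⟨gnsVector ρ₂, hξ⟩, gnsRep ρ₂ X (T ⟨gnsVector ρ₂, hξ⟩)⟫_ℂ

end GNS

end CStarState

/-! The argument compares GNS spaces through τ = ρ₁ + ρ₂. As ρ₂ ≤ τ, sending class to class gives a
contraction V from the GNS space of τ to that of ρ₂, and almost domination forces V to be injective
(`AlmostDominated.injective_comparison`).

2 → 3: B = V V⋆ commutes with the representation, and T = (1 - B)^{1/2} B^{-1/2} is the density,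
because ‖(1 - B)^{1/2} y‖² = ‖y‖² - ‖B^{1/2} y‖² becomes ρ₁ = τ - ρ₂. 3 → 2: X ξ ↦ π(X) T ξ is a
restriction of the closed operator T, hence closable. 1 → 2: convergence in L¹(μ₂) gives a
subsequence converging μ₂-a.e., hence μ₁-a.e., and Fatou's lemma concludes. 2 → 1: Q = V⋆ V
represents ρ₂ and 1 - Q represents ρ₁. Injectivity of Q gives 1 - Q = ∑_{n ≥ 1} Q (1 - Q)^n strongly
(`hasSum_inner_mul_one_sub_pow`), with every term below Q. So ρ₁ is a countable sum of functionals
below ρ₂, and discrete measures suffice (`absolutelyContinuous_of_hasSum`). -/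

namespace CStarState

/-! ### GNS spaces and the comparison maps between them -/

section GNSLemmas

variable {A : Type*} [CStarAlgebra A] [PartialOrder A] [StarOrderedRing A]

/-- The class of an element of the algebra in the GNS space of a positive functional. -/
noncomputable def gnsClass (f : A →ₚ[ℂ] ℂ) : A →ₗ[ℂ] f.GNS where
  toFun a := ((f.toPreGNS a : f.PreGNS) : f.GNS)
  map_add' a b := by rw [map_add, UniformSpace.Completion.coe_add]
  map_smul' c a := by rw [map_smul, UniformSpace.Completion.coe_smul, RingHom.id_apply]

theorem inner_gnsClass (f : A →ₚ[ℂ] ℂ) (a b : A) :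
    ⟪gnsClass f a, gnsClass f b⟫_ℂ = f (star a * b) :=
  (UniformSpace.Completion.inner_coe _ _).trans (f.preGNS_inner_def _ _)

theorem norm_gnsClass_sq (f : A →ₚ[ℂ] ℂ) (a : A) :
    ((‖gnsClass f a‖ ^ 2 : ℝ) : ℂ) = f (star a * a) := by
  rw [← inner_gnsClass, inner_self_eq_norm_sq_to_K]
  norm_cast

theorem gnsStarAlgHom_gnsClass (f : A →ₚ[ℂ] ℂ) (X a : A) :
    f.gnsStarAlgHom X (gnsClass f a) = gnsClass f (X * a) :=
  f.gnsNonUnitalStarAlgHom_apply_coe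

theorem denseRange_gnsClass (f : A →ₚ[ℂ] ℂ) : DenseRange (gnsClass f) :=
  UniformSpace.Completion.denseRange_coe (α := f.PreGNS)

theorem apply_eq_inner_gnsClass_one (f : A →ₚ[ℂ] ℂ) (X : A) :
    f X = ⟪gnsClass f 1, f.gnsStarAlgHom X (gnsClass f 1)⟫_ℂ := by
  rw [gnsStarAlgHom_gnsClass, inner_gnsClass]
  simp

theorem tendsto_norm_gnsClass_iff {ι : Type*} {l : Filter ι} (f : A →ₚ[ℂ] ℂ) (u : ι → A) :
    Tendsto (fun i => gnsClass f (u i)) l (𝓝 0) ↔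
      Tendsto (fun i => f (star (u i) * u i)) l (𝓝 0) := by
  simp_rw [← norm_gnsClass_sq]
  rw [tendsto_zero_iff_norm_tendsto_zero]
  constructor
  · intro h
    have h2 : Tendsto (fun i => ‖gnsClass f (u i)‖ ^ 2) l (𝓝 0) := by simpa using h.pow 2
    simpa [Function.comp_def] using (Complex.continuous_ofReal.tendsto 0).comp h2
  · intro h
    have := (Real.continuous_sqrt.tendsto 0).comp (tendsto_zero_iff_norm_tendsto_zero.1 h)
    simpa [Function.comp_def] using this

/-- The canonical map between GNS spaces for `f ≤ g`. -/
theorem exists_gnsComparison (f g : A →ₚ[ℂ] ℂ) (h : ∀ a, 0 ≤ a → f a ≤ g a) :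
    ∃ V : g.GNS →L[ℂ] f.GNS, (∀ a, V (gnsClass g a) = gnsClass f a) ∧ ‖V‖ ≤ 1 := by
  let L : g.PreGNS →L[ℂ] f.PreGNS :=
    (f.toPreGNS.toLinearMap ∘ₗ g.ofPreGNS.toLinearMap).mkContinuous 1 fun x => by
      rw [one_mul, f.preGNS_norm_def, g.preGNS_norm_def]
      exact Real.sqrt_le_sqrt (Complex.le_def.1 (h _ (star_mul_self_nonneg _))).1
  refine ⟨L.completion, fun a => L.completion_apply_coe _, ?_⟩
  refine L.completion.opNorm_le_bound zero_le_one fun k => ?_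
  induction k using UniformSpace.Completion.induction_on with
  | hp => exact isClosed_le (by fun_prop) (by fun_prop)
  | ih a =>
    rw [L.completion_apply_coe, UniformSpace.Completion.norm_coe, UniformSpace.Completion.norm_coe]
    exact L.le_of_opNorm_le (LinearMap.mkContinuous_norm_le _ zero_le_one _) a

theorem gns_comparison_comp {f g : A →ₚ[ℂ] ℂ} {V : g.GNS →L[ℂ] f.GNS}
    (hV : ∀ a, V (gnsClass g a) = gnsClass f a) (X : A) :
    V ∘L g.gnsStarAlgHom X = f.gnsStarAlgHom X ∘L V := by
  refine ContinuousLinearMap.ext fun k => ?_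
  refine congr_fun ((denseRange_gnsClass g).equalizer (by fun_prop) (by fun_prop) ?_) k
  funext a
  simp [gnsStarAlgHom_gnsClass, hV, - PositiveLinearMap.gnsStarAlgHom_apply]

/-- The elements `star a * a` are the nonnegative ones, and these span the algebra. -/
theorem linearMap_eq_of_star_mul_self {E : Type*} [AddCommGroup E] [Module ℂ E]
    (φ ψ : A →ₗ[ℂ] E) (h : ∀ a, φ (star a * a) = ψ (star a * a)) : φ = ψ := by
  refine LinearMap.ext_on (CStarAlgebra.span_nonneg (A := A)) fun a ha => ?_
  obtain ⟨b, rfl⟩ := CStarAlgebra.nonneg_iff_eq_star_mul_self.1 ha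
  exact h b

end GNSLemmas

/-! ### The unbounded quotient C S⁻¹ of commuting positive operators -/

section Hilbert

variable {H : Type*} [NormedAddCommGroup H] [InnerProductSpace ℂ H]

theorem inner_apply_nonneg {S : H →L[ℂ] H} (hS : 0 ≤ S) (x : H) : 0 ≤ ⟪x, S x⟫_ℂ :=
  ((ContinuousLinearMap.nonneg_iff_isPositive S).1 hS).inner_nonneg_right x

/-- The partially defined operator `C S⁻¹` with domain the range of the injective operator `S`. -/
noncomputable def compInverse (C S : H →L[ℂ] H) (hS : Function.Injective S) : H →ₗ.[ℂ] H where
  domain := LinearMap.range S.toLinearMap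
  toFun := C.toLinearMap ∘ₗ (LinearEquiv.ofInjective S.toLinearMap hS).symm.toLinearMap

theorem mem_domain_compInverse {C S : H →L[ℂ] H} {hS : Function.Injective S} (y : H) :
    S y ∈ (compInverse C S hS).domain := ⟨y, rfl⟩

theorem compInverse_apply {C S : H →L[ℂ] H} {hS : Function.Injective S} (y : H)
    (h : S y ∈ (compInverse C S hS).domain) : compInverse C S hS ⟨S y, h⟩ = C y := by
  change C ((LinearEquiv.ofInjective S.toLinearMap hS).symm ⟨S y, h⟩) = C y
  congr 1
  rw [LinearEquiv.symm_apply_eq]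
  rfl

variable [CompleteSpace H]

theorem inner_apply_comm_of_nonneg {S : H →L[ℂ] H} (hS : 0 ≤ S) (x y : H) :
    ⟪S x, y⟫_ℂ = ⟪x, S y⟫_ℂ := by
  conv_lhs => rw [← (IsSelfAdjoint.of_nonneg hS).adjoint_eq]
  exact ContinuousLinearMap.adjoint_inner_left S y x

theorem denseRange_of_injective_of_nonneg {S : H →L[ℂ] H} (hS : 0 ≤ S)
    (hinj : Function.Injective S) : DenseRange S := by
  have h1 : S.rangeᗮ = ⊥ := by
    rw [ContinuousLinearMap.orthogonal_range, (IsSelfAdjoint.of_nonneg hS).adjoint_eq]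
    exact LinearMap.ker_eq_bot.2 hinj
  exact (Submodule.dense_iff_topologicalClosure_eq_top).2
    ((Submodule.topologicalClosure_eq_top_iff).2 h1)

theorem isPositive_compInverse {C S : H →L[ℂ] H} {hinj : Function.Injective S} (hS : 0 ≤ S)
    (hC : 0 ≤ C) (hcomm : Commute S C) : IsPositive (compInverse C S hinj) := by
  rintro ⟨_, y, rfl⟩
  refine (inner_apply_nonneg (hcomm.mul_nonneg hS hC) y).trans_eq ?_
  exact (inner_apply_comm_of_nonneg hS y (C y)).symm.trans
    (congrArg _ (compInverse_apply y (mem_domain_compInverse y)).symm)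

/-- Symmetry comes from commutation. If z lies in the domain of the adjoint, with image w, then C z
= S w, so z = S² z + C² z = S (S z + C w) already lies in the range of S. -/
theorem isSelfAdjoint_compInverse {C S : H →L[ℂ] H} {hinj : Function.Injective S} (hS : 0 ≤ S)
    (hC : 0 ≤ C) (hcomm : Commute S C) (hsum : S * S + C * C = 1) :
    IsSelfAdjoint (compInverse C S hinj) := by
  have hdense : Dense ((compInverse C S hinj).domain : Set H) :=
    denseRange_of_injective_of_nonneg hS hinj
  have hSC : ∀ x, S (C x) = C (S x) := fun x => DFunLike.congr_fun hcomm.eq x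
  rw [LinearPMap.isSelfAdjoint_def]
  symm
  refine LinearPMap.eq_of_le_of_domain_eq (LinearPMap.IsFormalAdjoint.le_adjoint hdense ?_)
    (le_antisymm (LinearPMap.IsFormalAdjoint.le_adjoint hdense ?_).1 ?_)
  -- The symmetry identity is needed twice: for T ≤ T† and for the inclusion of domains.
  iterate 2
    rintro ⟨_, x, rfl⟩ ⟨_, y, rfl⟩
    erw [compInverse_apply x, compInverse_apply y]
    change ⟪C x, S y⟫_ℂ = ⟪S x, C y⟫_ℂ
    rw [inner_apply_comm_of_nonneg hC, inner_apply_comm_of_nonneg hS, hSC]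
  intro z hz
  set w := (compInverse C S hinj).adjoint ⟨z, hz⟩ with hw
  have key : C z = S w := by
    refine ext_inner_right ℂ fun y => ?_
    have := LinearPMap.adjoint_isFormalAdjoint hdense ⟨z, hz⟩ ⟨S y, mem_domain_compInverse y⟩
    rw [compInverse_apply] at this
    rw [inner_apply_comm_of_nonneg hC, inner_apply_comm_of_nonneg hS]
    exact this.symm
  refine ⟨S z + C w, ?_⟩
  have h1 : S (S z) + C (C z) = z := DFunLike.congr_fun hsum z
  change S (S z + C w) = z
  rw [map_add, hSC, ← key, h1]

end Hilbert

/-! ### The sum of two states, and almost domination as injectivity -/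

section Injective

variable {A : Type*} [CStarAlgebra A] [PartialOrder A] [StarOrderedRing A]

theorem toPositive_apply (ρ : State A) (X : A) : toPositive ρ X = ρ.1 X := rfl

theorem gnsRep_gnsClass (ρ : State A) (X a : A) :
    gnsRep ρ X (gnsClass (toPositive ρ) a) = gnsClass (toPositive ρ) (X * a) :=
  gnsStarAlgHom_gnsClass _ X a

theorem gnsRep_gnsVector (ρ : State A) (X : A) :
    gnsRep ρ X (gnsVector ρ) = gnsClass (toPositive ρ) X :=
  (gnsRep_gnsClass ρ X 1).trans (by rw [mul_one])

/-- The sum of two states. -/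
noncomputable def stateSum (ρ₁ ρ₂ : State A) : A →ₚ[ℂ] ℂ :=
  toPositive ρ₁ + toPositive ρ₂

theorem stateSum_apply (ρ₁ ρ₂ : State A) (X : A) : stateSum ρ₁ ρ₂ X = ρ₁.1 X + ρ₂.1 X := rfl

theorem exists_gnsComparison_left (ρ₁ ρ₂ : State A) :
    ∃ V : (stateSum ρ₁ ρ₂).GNS →L[ℂ] GNSSpace ρ₁,
      (∀ a, V (gnsClass _ a) = gnsClass (toPositive ρ₁) a) ∧ ‖V‖ ≤ 1 :=
  exists_gnsComparison _ _ fun a ha => by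
    rw [stateSum_apply, toPositive_apply]
    exact le_add_of_nonneg_right (ρ₂.2.1 a ha)

theorem exists_gnsComparison_right (ρ₁ ρ₂ : State A) :
    ∃ V : (stateSum ρ₁ ρ₂).GNS →L[ℂ] GNSSpace ρ₂,
      (∀ a, V (gnsClass _ a) = gnsClass (toPositive ρ₂) a) ∧ ‖V‖ ≤ 1 :=
  exists_gnsComparison _ _ fun a ha => by
    rw [stateSum_apply, toPositive_apply]
    exact le_add_of_nonneg_left (ρ₁.2.1 a ha)

/-- Approximate a kernel vector k by classes of X n. The sequence is Cauchy for ρ₁ and null for ρ₂,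
hence null for ρ₁, hence null for the sum, so k = 0. -/
theorem AlmostDominated.injective_comparison {ρ₁ ρ₂ : State A} (h : AlmostDominated ρ₁ ρ₂)
    {V : (stateSum ρ₁ ρ₂).GNS →L[ℂ] GNSSpace ρ₂}
    (hV : ∀ a, V (gnsClass _ a) = gnsClass (toPositive ρ₂) a) : Function.Injective V := by
  refine (injective_iff_map_eq_zero V).2 fun k hk => ?_
  obtain ⟨W, hW, -⟩ := exists_gnsComparison_left ρ₁ ρ₂
  obtain ⟨x, hx, hxk⟩ := mem_closure_iff_seq_limit.1 (denseRange_gnsClass (stateSum ρ₁ ρ₂) k)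
  choose X hX using hx
  obtain rfl : (fun n => gnsClass _ (X n)) = x := funext hX
  have hcauchy : Tendsto (fun p : ℕ × ℕ => gnsClass (stateSum ρ₁ ρ₂) (X p.1 - X p.2)) atTop
      (𝓝 0) := by
    rw [← prod_atTop_atTop_eq]
    simpa only [map_sub, sub_self, Function.comp_def] using
      (hxk.comp tendsto_fst).sub (hxk.comp tendsto_snd)
  have h1 := (W.continuous.tendsto 0).comp hcauchy
  have h2 := (V.continuous.tendsto k).comp hxk
  simp only [Function.comp_def, hW, hV, map_zero, hk] at h1 h2
  have h3 := h X ((tendsto_norm_gnsClass_iff _ _).1 h1) ((tendsto_norm_gnsClass_iff _ _).1 h2)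
  refine tendsto_nhds_unique hxk ((tendsto_norm_gnsClass_iff _ _).2 ?_)
  have h4 := h3.add ((tendsto_norm_gnsClass_iff _ _).1 h2)
  rw [add_zero] at h4
  exact h4

end Injective

/-! ### Affiliation, and the range of a positive square root -/

section Hilbert

variable {H K : Type*} [NormedAddCommGroup H] [InnerProductSpace ℂ H] [CompleteSpace H]
  [NormedAddCommGroup K] [InnerProductSpace ℂ K] [CompleteSpace K]

theorem mem_repCommutant_iff {A : Type*} [CStarAlgebra A] {π : A →⋆ₐ[ℂ] (H →L[ℂ] H)}
    {S : H →L[ℂ] H} : S ∈ repCommutant π ↔ ∀ X, Commute (π X) S := by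
  refine (StarSubalgebra.mem_centralizer_iff ℂ).trans
    ⟨fun h X => (h _ ⟨X, rfl⟩).1, ?_⟩
  rintro h _ ⟨X, rfl⟩
  exact ⟨h X, by rw [← map_star]; exact h (star X)⟩

theorem isAffiliated_compInverse {M : VonNeumannAlgebra H} {C S : H →L[ℂ] H}
    (hinj : Function.Injective S) (hS : S ∈ M) (hC : C ∈ M) :
    IsAffiliated M (compInverse C S hinj) := by
  rintro U hU - ⟨_, y, rfl⟩
  rw [VonNeumannAlgebra.mem_commutant_iff] at hU
  have hSU : S (U y) = U (S y) := DFunLike.congr_fun (hU S hS) y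
  have hCU : C (U y) = U (C y) := DFunLike.congr_fun (hU C hC) y
  refine ⟨⟨U y, hSU⟩, ?_⟩
  have : ∀ (z : H) (hz : z ∈ (compInverse C S hinj).domain), z = S (U y) →
      compInverse C S hinj ⟨z, hz⟩ = C (U y) := by
    rintro _ hz rfl
    exact compInverse_apply _ hz
  refine (this _ _ hSU.symm).trans (hCU.trans (congrArg U ?_))
  exact (compInverse_apply y (mem_domain_compInverse y)).symm

/-- If `S² = V V⋆` with `V` injective and `S` positive, the range of `V` lies in the range
of `S`. -/
theorem exists_apply_eq_of_mul_self_eq {S : H →L[ℂ] H} (hS : 0 ≤ S) {V : K →L[ℂ] H}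
    (hV : Function.Injective V) (hSV : S * S = V ∘L V.adjoint) (k : K) :
    ∃ y, S y = V k ∧ ‖y‖ = ‖k‖ := by
  -- So V⋆ z ↦ S z is isometric on the range of V⋆, which is dense as V is injective; y is the image
  -- of k under its extension.
  have hnorm : ∀ z, ‖S z‖ = ‖V.adjoint z‖ := fun z => by
    have h1 : ⟪S z, S z⟫_ℂ = ⟪V.adjoint z, V.adjoint z⟫_ℂ := by
      rw [inner_apply_comm_of_nonneg hS, ContinuousLinearMap.adjoint_inner_left]
      exact congrArg _ (DFunLike.congr_fun hSV z)
    rw [inner_self_eq_norm_sq_to_K, inner_self_eq_norm_sq_to_K] at h1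
    exact (sq_eq_sq₀ (norm_nonneg _) (norm_nonneg _)).1 (by exact_mod_cast h1)
  have hdense : DenseRange V.adjoint := by
    have h1 : V.adjoint.rangeᗮ = ⊥ := by
      rw [ContinuousLinearMap.orthogonal_range, ContinuousLinearMap.adjoint_adjoint]
      exact LinearMap.ker_eq_bot.2 hV
    exact (Submodule.dense_iff_topologicalClosure_eq_top).2
      ((Submodule.topologicalClosure_eq_top_iff).2 h1)
  obtain ⟨x, hx, hxk⟩ := mem_closure_iff_seq_limit.1 (hdense k)
  choose z hz using hx
  obtain rfl : (fun n => V.adjoint (z n)) = x := funext hz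
  have hcauchy : CauchySeq fun n => S (z n) := by
    refine Metric.cauchySeq_iff.2 fun ε hε => ?_
    obtain ⟨N, hN⟩ := Metric.cauchySeq_iff.1 hxk.cauchySeq ε hε
    refine ⟨N, fun m hm n hn => ?_⟩
    have := hN m hm n hn
    rwa [dist_eq_norm, ← map_sub, ← hnorm, map_sub, ← dist_eq_norm] at this
  obtain ⟨y, hy⟩ := cauchySeq_tendsto_of_complete hcauchy
  refine ⟨y, tendsto_nhds_unique ((S.continuous.tendsto y).comp hy) ?_,
    tendsto_nhds_unique hy.norm ?_⟩
  · refine ((V.continuous.tendsto k).comp hxk).congr fun n => ?_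
    exact (DFunLike.congr_fun hSV (z n)).symm
  · simpa only [hnorm] using hxk.norm

theorem comp_adjoint_le_one {V : K →L[ℂ] H} (hV : ‖V‖ ≤ 1) : V ∘L V.adjoint ≤ 1 := by
  have h0 : 0 ≤ V ∘L V.adjoint :=
    (ContinuousLinearMap.nonneg_iff_isPositive _).2 V.isPositive_self_comp_adjoint
  refine (CStarAlgebra.norm_le_one_iff_of_nonneg _ h0).1 ?_
  refine (V.opNorm_comp_le _).trans (mul_le_one₀ hV (norm_nonneg _) ?_)
  rwa [LinearIsometryEquiv.norm_map]

end Hilbert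

/-! ### From almost domination to an affiliated density -/

section Density

variable {A : Type*} [CStarAlgebra A] [PartialOrder A] [StarOrderedRing A]

theorem adjoint_comparison_comp {f g : A →ₚ[ℂ] ℂ} {V : g.GNS →L[ℂ] f.GNS}
    (hV : ∀ a, V (gnsClass g a) = gnsClass f a) (X : A) :
    V.adjoint ∘L f.gnsStarAlgHom X = g.gnsStarAlgHom X ∘L V.adjoint := by
  have := congrArg ContinuousLinearMap.adjoint (gns_comparison_comp hV (star X))
  simpa only [ContinuousLinearMap.adjoint_comp, map_star, ContinuousLinearMap.star_eq_adjoint,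
    ContinuousLinearMap.adjoint_adjoint] using this.symm

theorem commute_comparison_comp_adjoint {f g : A →ₚ[ℂ] ℂ} {V : g.GNS →L[ℂ] f.GNS}
    (hV : ∀ a, V (gnsClass g a) = gnsClass f a) (X : A) :
    Commute (f.gnsStarAlgHom X) (V ∘L V.adjoint) := by
  change f.gnsStarAlgHom X ∘L (V ∘L V.adjoint) = (V ∘L V.adjoint) ∘L f.gnsStarAlgHom X
  rw [ContinuousLinearMap.comp_assoc, adjoint_comparison_comp hV,
    ← ContinuousLinearMap.comp_assoc, ← ContinuousLinearMap.comp_assoc, gns_comparison_comp hV]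

theorem denseRange_comparison {f g : A →ₚ[ℂ] ℂ} {V : g.GNS →L[ℂ] f.GNS}
    (hV : ∀ a, V (gnsClass g a) = gnsClass f a) : DenseRange V :=
  (denseRange_gnsClass f).mono (by rintro _ ⟨a, rfl⟩; exact ⟨_, hV a⟩)

theorem AlmostDominated.hasAffiliatedDensity {ρ₁ ρ₂ : State A} (h : AlmostDominated ρ₁ ρ₂) :
    HasAffiliatedDensity ρ₁ ρ₂ := by
  obtain ⟨V, hV, hVnorm⟩ := exists_gnsComparison_right ρ₁ ρ₂
  have hVinj := h.injective_comparison hV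
  set B := V ∘L V.adjoint with hB
  have hB0 : 0 ≤ B :=
    (ContinuousLinearMap.nonneg_iff_isPositive _).2 V.isPositive_self_comp_adjoint
  have hB1 : 0 ≤ 1 - B := sub_nonneg.2 (comp_adjoint_le_one hVnorm)
  set S := CFC.sqrt B
  set C := CFC.sqrt (1 - B)
  have hS : 0 ≤ S := CFC.sqrt_nonneg B
  have hC : 0 ≤ C := CFC.sqrt_nonneg _
  have hSS : S * S = B := CFC.sqrt_mul_sqrt_self B
  have hCC : C * C = 1 - B := CFC.sqrt_mul_sqrt_self _
  have hcomm : Commute S C := by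
    refine Commute.cfcₙ_nnreal ?_ _
    refine ((Commute.cfcₙ_nnreal ?_ _).symm)
    exact (Commute.one_left B).sub_left (Commute.refl B)
  have hsum : S * S + C * C = 1 := by rw [hSS, hCC, add_sub_cancel]
  have hBπ : ∀ X, Commute (gnsRep ρ₂ X) B := commute_comparison_comp_adjoint hV
  have hSπ : ∀ X, Commute (gnsRep ρ₂ X) S := fun X => ((hBπ X).symm.cfcₙ_nnreal _).symm
  have hCπ : ∀ X, Commute (gnsRep ρ₂ X) C := fun X =>
    (Commute.cfcₙ_nnreal ((Commute.one_right _).sub_right (hBπ X)).symm _).symm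
  -- Both properties of V enter: V is injective, and V⋆ is injective because V has dense range.
  have hSinj : Function.Injective S := by
    refine (injective_iff_map_eq_zero S).2 fun x hx => ?_
    have h1 : V (V.adjoint x) = 0 := by
      rw [← ContinuousLinearMap.comp_apply, ← hB, ← hSS, mul_apply_eq_comp, hx,
        map_zero]
    have h2 : V.adjoint x = 0 := hVinj (by rw [h1, map_zero])
    refine (denseRange_comparison hV).eq_zero_of_inner_left ℂ fun k => ?_
    rw [← ContinuousLinearMap.adjoint_inner_left, h2, inner_zero_left]
  have hpre := fun a => exists_apply_eq_of_mul_self_eq hS hVinj hSS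
    (gnsClass (stateSum ρ₁ ρ₂) a)
  choose y hy hynorm using hpre
  -- Equivariance makes it enough to know T at the cyclic vector: π(X) T ξ = C (y X).
  have hyX : ∀ X, gnsRep ρ₂ X (y 1) = y X := fun X => hSinj <| by
    rw [hy, hV]
    have : S (gnsRep ρ₂ X (y 1)) = gnsRep ρ₂ X (S (y 1)) :=
      DFunLike.congr_fun (hSπ X).symm.eq (y 1)
    rw [this, hy, hV, gnsRep_gnsClass, mul_one]
  have hξ : S (y 1) = gnsVector ρ₂ := (hy 1).trans (hV 1)
  have hdom : gnsVector ρ₂ ∈ (compInverse C S hSinj).domain := ⟨y 1, hξ⟩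
  have hTξ : compInverse C S hSinj ⟨gnsVector ρ₂, hdom⟩ = C (y 1) := by
    rw [← compInverse_apply (hS := hSinj) (y 1) (mem_domain_compInverse (y 1))]
    congr 1
    exact Subtype.ext hξ.symm
  refine ⟨compInverse C S hSinj, isSelfAdjoint_compInverse hS hC hcomm hsum,
    isPositive_compInverse hS hC hcomm,
    isAffiliated_compInverse hSinj (mem_repCommutant_iff.2 hSπ) (mem_repCommutant_iff.2 hCπ),
    hdom, fun X => ?_⟩
  rw [hTξ]
  have hlin := linearMap_eq_of_star_mul_self (ρ₁.1 : A →L[ℂ] ℂ).toLinearMap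
    ((innerSL ℂ (C (y 1))).toLinearMap ∘ₗ
      (LinearMap.applyₗ (C (y 1))) ∘ₗ (ContinuousLinearMap.coeLM ℂ) ∘ₗ
        (gnsRep ρ₂).toAlgHom.toLinearMap) fun a => ?_
  · exact DFunLike.congr_fun hlin X
  change ρ₁.1 (star a * a) = ⟪C (y 1), gnsRep ρ₂ (star a * a) (C (y 1))⟫_ℂ
  -- The remaining computation is ‖C (y a)‖² = ‖y a‖² - ‖S (y a)‖² = (ρ₁ + ρ₂)(a⋆a) - ρ₂(a⋆a).
  have e1 : gnsRep ρ₂ a (C (y 1)) = C (y a) := by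
    rw [← hyX a]
    exact DFunLike.congr_fun (hCπ a).eq (y 1)
  have e2 : ⟪C (y 1), gnsRep ρ₂ (star a * a) (C (y 1))⟫_ℂ = ⟪C (y a), C (y a)⟫_ℂ := by
    rw [map_mul, map_star, mul_apply_eq_comp, ContinuousLinearMap.star_eq_adjoint,
      ContinuousLinearMap.adjoint_inner_right, e1]
  have e3 : C (C (y a)) = y a - S (S (y a)) := by
    rw [← mul_apply_eq_comp, ← mul_apply_eq_comp, hCC, hSS]
    rfl
  have e4 : ⟪y a, y a⟫_ℂ = ρ₁.1 (star a * a) + ρ₂.1 (star a * a) := by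
    rw [inner_self_eq_norm_sq_to_K, hynorm, ← stateSum_apply, ← norm_gnsClass_sq]
    norm_cast
  rw [e2, inner_apply_comm_of_nonneg hC, e3, inner_sub_right, ← inner_apply_comm_of_nonneg hS, e4,
    hy, hV, inner_gnsClass, toPositive_apply, add_sub_cancel_right]

end Density

/-! ### From an affiliated density to almost domination -/

section Closable

variable {A : Type*} [CStarAlgebra A] [PartialOrder A] [StarOrderedRing A]

/-- For unitary X this is affiliation applied to π(X). Unitaries span the algebra and the graph is a
linear subspace. -/
theorem IsAffiliated.mem_graph {ρ : State A} {T : GNSSpace ρ →ₗ.[ℂ] GNSSpace ρ}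
    (hT : IsAffiliated (repCommutant (gnsRep ρ)) T) (hξ : gnsVector ρ ∈ T.domain) (X : A) :
    (gnsClass (toPositive ρ) X, gnsRep ρ X (T ⟨gnsVector ρ, hξ⟩)) ∈ T.graph := by
  induction (CStarAlgebra.span_unitary A).symm ▸ Submodule.mem_top (x := X) using
    Submodule.span_induction with
  | mem u hu =>
    obtain ⟨h, hTu⟩ := hT (gnsRep ρ u)
      (VonNeumannAlgebra.mem_commutant_iff.2 fun g hg => (mem_repCommutant_iff.1 hg u).symm.eq)
      (Unitary.map_mem _ hu) ⟨_, hξ⟩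
    refine (LinearPMap.mem_graph_iff T).2 ⟨⟨_, h⟩, gnsRep_gnsVector ρ u, hTu⟩
  | zero =>
    simp only [map_zero, zero_apply]
    exact zero_mem _
  | add a b _ _ ha hb =>
    simp only [map_add, add_apply]
    exact add_mem ha hb
  | smul c a _ ha =>
    simp only [map_smul, smul_apply]
    exact T.graph.smul_mem c ha

/-- A ρ₁-Cauchy sequence makes π(X n) T ξ converge to some z. Since T is self-adjoint its graph is
closed, so it contains (0, z) and z = 0. -/
theorem HasAffiliatedDensity.almostDominated {ρ₁ ρ₂ : State A} (h : HasAffiliatedDensity ρ₁ ρ₂) :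
    AlmostDominated ρ₁ ρ₂ := by
  obtain ⟨T, hsa, -, haff, hξ, hρ⟩ := h
  set η := T ⟨gnsVector ρ₂, hξ⟩ with hη
  have hnorm : ∀ a, ρ₁.1 (star a * a) = ((‖gnsRep ρ₂ a η‖ ^ 2 : ℝ) : ℂ) := fun a => by
    rw [hρ, map_mul, map_star, mul_apply_eq_comp, ContinuousLinearMap.star_eq_adjoint,
      ContinuousLinearMap.adjoint_inner_right, inner_self_eq_norm_sq_to_K]
    norm_cast
  intro X hcauchy hzero
  simp only [hnorm] at hcauchy ⊢
  have hc : CauchySeq fun n => gnsRep ρ₂ (X n) η := by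
    rw [cauchySeq_iff_tendsto_dist_atTop_0]
    have h1 := (Real.continuous_sqrt.tendsto 0).comp
      ((Complex.continuous_re.tendsto 0).comp hcauchy)
    simpa only [Function.comp_def, Complex.ofReal_re, Complex.zero_re, Real.sqrt_zero,
      map_sub, sub_apply, ← dist_eq_norm,
      Real.sqrt_sq dist_nonneg] using h1
  obtain ⟨z, hz⟩ := cauchySeq_tendsto_of_complete hc
  have hgraph : ((0 : GNSSpace ρ₂), z) ∈ T.graph :=
    (hsa.isClosed : IsClosed (T.graph : Set (GNSSpace ρ₂ × GNSSpace ρ₂))).mem_of_tendsto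
      (((tendsto_norm_gnsClass_iff (toPositive ρ₂) X).2 hzero).prodMk_nhds hz)
      (Eventually.of_forall fun n => haff.mem_graph hξ (X n))
  have hz0 : z = 0 := T.graph_fst_eq_zero_snd hgraph rfl
  rw [hz0] at hz
  have h2 := (Complex.continuous_ofReal.tendsto _).comp (hz.norm.pow 2)
  rw [norm_zero, zero_pow two_ne_zero, Complex.ofReal_zero] at h2
  exact h2

end Closable

/-! ### Integration over the state space: from measures to almost domination -/

section Integrals

variable {A : Type*} [CStarAlgebra A] [PartialOrder A]

theorem continuous_state_apply (X : A) : Continuous fun φ : State A => φ.1 X :=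
  (WeakDual.eval_continuous X).comp continuous_subtype_val

variable [StarOrderedRing A]

theorem norm_state_apply_le (φ : State A) (X : A) : ‖φ.1 X‖ ≤ ‖X‖ := by
  have hξ : ‖gnsVector φ‖ = 1 := by
    have h := norm_gnsClass_sq (toPositive φ) 1
    rw [star_one, mul_one, toPositive_apply, φ.2.2, ← Complex.ofReal_one,
      Complex.ofReal_inj] at h
    exact (pow_eq_one_iff_of_nonneg (norm_nonneg _) two_ne_zero).1 h
  calc ‖φ.1 X‖ = ‖⟪gnsVector φ, gnsRep φ X (gnsVector φ)⟫_ℂ‖ :=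
        congrArg _ (apply_eq_inner_gnsClass_one (toPositive φ) X)
    _ ≤ ‖gnsVector φ‖ * (‖gnsRep φ X‖ * ‖gnsVector φ‖) :=
        (norm_inner_le_norm _ _).trans (by gcongr; exact ContinuousLinearMap.le_opNorm _ _)
    _ ≤ ‖X‖ := by
        rw [hξ, one_mul, mul_one]
        exact NonUnitalStarAlgHom.norm_apply_le _ X

theorem integrable_state_apply (μ : Measure (State A)) [IsFiniteMeasure μ] (X : A) :
    Integrable (fun φ : State A => φ.1 X) μ :=
  .of_bound (continuous_state_apply X).aestronglyMeasurable ‖X‖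
    (Eventually.of_forall fun φ => norm_state_apply_le φ X)

theorem coe_norm_gnsClass_sq (φ : State A) (X : A) :
    ((‖gnsClass (toPositive φ) X‖ ^ 2 : ℝ) : ℂ) = φ.1 (star X * X) :=
  norm_gnsClass_sq _ X

theorem norm_gnsClass_sq_eq_re (φ : State A) (X : A) :
    ‖gnsClass (toPositive φ) X‖ ^ 2 = (φ.1 (star X * X)).re := by
  rw [← coe_norm_gnsClass_sq, Complex.ofReal_re]

theorem continuous_norm_gnsClass_sq (X : A) :
    Continuous fun φ : State A => ‖gnsClass (toPositive φ) X‖ ^ 2 := by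
  simp only [norm_gnsClass_sq_eq_re]
  exact Complex.continuous_re.comp (continuous_state_apply _)

theorem IsBarycenter.lintegral_norm_sq {ρ : State A} {μ : Measure (State A)} [IsFiniteMeasure μ]
    (h : IsBarycenter ρ μ) (X : A) :
    ∫⁻ φ : State A, ENNReal.ofReal (‖gnsClass (toPositive φ) X‖ ^ 2) ∂μ =
      ENNReal.ofReal (‖gnsClass (toPositive ρ) X‖ ^ 2) := by
  have hint := integrable_state_apply μ (star X * X)
  have h1 : ‖gnsClass (toPositive ρ) X‖ ^ 2 =
      ∫ φ : State A, ‖gnsClass (toPositive φ) X‖ ^ 2 ∂μ := by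
    simp only [norm_gnsClass_sq_eq_re]
    rw [h]
    exact (integral_re hint).symm
  rw [h1, ofReal_integral_eq_lintegral_ofReal]
  · simp only [norm_gnsClass_sq_eq_re]
    exact hint.re
  · exact Eventually.of_forall fun φ => sq_nonneg _

theorem AbsolutelyContinuous.almostDominated {ρ₁ ρ₂ : State A} (h : AbsolutelyContinuous ρ₁ ρ₂) :
    AlmostDominated ρ₁ ρ₂ := by
  obtain ⟨μ₁, μ₂, hμ₁, -, hμ₂, -, hb₁, hb₂, hac⟩ := h
  intro X hcauchy hzero
  simp only [← toPositive_apply, ← tendsto_norm_gnsClass_iff] at hcauchy hzero ⊢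
  set q : A → State A → ℝ := fun Y φ => ‖gnsClass (toPositive φ) Y‖ ^ 2 with hq
  have hmeas : ∀ Y, Measurable (q Y) := fun Y => (continuous_norm_gnsClass_sq Y).measurable
  have hsq : ∀ {ι : Type} {l : Filter ι} {ρ : State A} {u : ι → A},
      Tendsto (fun i => gnsClass (toPositive ρ) (u i)) l (𝓝 0) →
      Tendsto (fun i => ENNReal.ofReal (q (u i) ρ)) l (𝓝 0) := fun hu => by
    have := ENNReal.tendsto_ofReal (hu.norm.pow 2)
    rwa [norm_zero, zero_pow two_ne_zero, ENNReal.ofReal_zero] at this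
  -- The barycenter identity turns ρ₂-nullity into L¹(μ₂) convergence of φ ↦ φ(X⋆X), hence a.e.
  -- convergence along a subsequence.
  obtain ⟨ns, hmono, hns⟩ : ∃ ns : ℕ → ℕ, StrictMono ns ∧
      ∀ᵐ φ ∂μ₂, Tendsto (fun k => q (X (ns k)) φ) atTop (𝓝 0) := by
    refine (tendstoInMeasure_of_tendsto_eLpNorm (p := 1) (g := 0) one_ne_zero
      (fun n => (hmeas _).aestronglyMeasurable) aestronglyMeasurable_zero ?_).exists_seq_tendsto_ae
    refine (hsq hzero).congr fun n => ?_
    rw [sub_zero, eLpNorm_one_eq_lintegral_enorm, ← hb₂.lintegral_norm_sq]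
    exact lintegral_congr fun φ => (Real.enorm_of_nonneg (sq_nonneg _)).symm
  have hlim : ∀ᵐ φ ∂μ₁, ∀ m,
      Tendsto (fun k => ENNReal.ofReal (q (X m - X (ns k)) φ)) atTop
        (𝓝 (ENNReal.ofReal (q (X m) φ))) := by
    filter_upwards [hac.ae_le hns] with φ hφ m
    refine ENNReal.tendsto_ofReal (Tendsto.pow (Tendsto.norm ?_) 2)
    have h0 : Tendsto (fun k => gnsClass (toPositive φ) (X (ns k))) atTop (𝓝 0) := by
      rw [tendsto_zero_iff_norm_tendsto_zero]
      have := (Real.continuous_sqrt.tendsto 0).comp hφ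
      simpa only [Function.comp_def, hq, Real.sqrt_sq (norm_nonneg _), Real.sqrt_zero] using this
    simpa only [map_sub, sub_zero] using tendsto_const_nhds.sub h0
  -- Fatou's lemma bounds ρ₁ at X m by its values at X m - X (ns k), which the Cauchy hypothesis
  -- makes small.
  have hfatou : ∀ m, ENNReal.ofReal (q (X m) ρ₁) ≤
      liminf (fun k => ENNReal.ofReal (q (X m - X (ns k)) ρ₁)) atTop := fun m => by
    rw [← hb₁.lintegral_norm_sq]
    calc ∫⁻ φ, ENNReal.ofReal (q (X m) φ) ∂μ₁
        = ∫⁻ φ, liminf (fun k => ENNReal.ofReal (q (X m - X (ns k)) φ)) atTop ∂μ₁ :=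
          lintegral_congr_ae (hlim.mono fun φ hφ => (hφ m).liminf_eq.symm)
      _ ≤ liminf (fun k => ∫⁻ φ, ENNReal.ofReal (q (X m - X (ns k)) φ) ∂μ₁) atTop :=
          lintegral_liminf_le fun k => (hmeas _).ennreal_ofReal
      _ = _ := by simp only [hq, hb₁.lintegral_norm_sq]
  have hgoal : Tendsto (fun m => ENNReal.ofReal (q (X m) ρ₁)) atTop (𝓝 0) := by
    refine ENNReal.tendsto_nhds_zero.2 fun ε hε => ?_
    obtain ⟨⟨a, b⟩, hab⟩ := eventually_atTop.1 (ENNReal.tendsto_nhds_zero.1 (hsq hcauchy) ε hε)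
    filter_upwards [eventually_ge_atTop a] with m hm
    refine (hfatou m).trans (liminf_le_of_frequently_le' (Eventually.frequently ?_))
    filter_upwards [hmono.tendsto_atTop.eventually_ge_atTop b] with k hk
    exact hab (m, ns k) ⟨hm, hk⟩
  rw [tendsto_zero_iff_norm_tendsto_zero]
  have := (Real.continuous_sqrt.tendsto 0).comp
    ((ENNReal.tendsto_toReal ENNReal.zero_ne_top).comp hgoal)
  simpa only [Function.comp_def, hq, Real.sqrt_sq (norm_nonneg _), Real.sqrt_zero,
    ENNReal.toReal_ofReal (sq_nonneg _), ENNReal.toReal_zero] using this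

end Integrals

/-! ### The operator geometric series -/

section Powers

variable {H : Type*} [NormedAddCommGroup H] [InnerProductSpace ℂ H] [CompleteSpace H]

theorem inner_apply_self_eq_norm_sq_of_nonneg {S : H →L[ℂ] H} (hS : 0 ≤ S) (x : H) :
    ⟪x, S (S x)⟫_ℂ = ((‖S x‖ ^ 2 : ℝ) : ℂ) := by
  rw [← inner_apply_comm_of_nonneg hS, inner_self_eq_norm_sq_to_K]
  norm_cast

/-- Since D² ≤ D, the cross term satisfies ⟨w, D w⟩ ≥ ‖D w‖²; expand the square. -/
theorem norm_sub_apply_sq_le {D : H →L[ℂ] H} (h0 : 0 ≤ D) (h1 : D ≤ 1) (w : H) :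
    ‖w - D w‖ ^ 2 ≤ ‖w‖ ^ 2 - ‖D w‖ ^ 2 := by
  have hpos := inner_apply_nonneg
    (((Commute.one_right D).sub_right (Commute.refl D)).mul_nonneg h0 (sub_nonneg.2 h1)) w
  have hre : 0 ≤ (⟪w, D w⟫_ℂ).re - ‖D w‖ ^ 2 := by
    have h2 : ⟪w, (D * (1 - D)) w⟫_ℂ = ⟪w, D w⟫_ℂ - ((‖D w‖ ^ 2 : ℝ) : ℂ) := by
      rw [← inner_apply_self_eq_norm_sq_of_nonneg h0, ← inner_sub_right, ← map_sub]
      rfl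
    rw [h2] at hpos
    simpa only [Complex.sub_re, Complex.ofReal_re, Complex.zero_re] using (Complex.le_def.1 hpos).1
  have h3 := @norm_sub_sq ℂ H _ _ _ w (D w)
  rw [h3]
  change ‖w‖ ^ 2 - 2 * (⟪w, D w⟫_ℂ).re + ‖D w‖ ^ 2 ≤ _
  linarith

/-- The powers of `1 - Q` tend strongly to zero if `0 ≤ Q ≤ 1` and `Q` is injective. -/
theorem tendsto_one_sub_pow_apply {Q : H →L[ℂ] H} (h0 : 0 ≤ Q) (h1 : Q ≤ 1)
    (hinj : Function.Injective Q) (v : H) :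
    Tendsto (fun n => ((1 - Q) ^ n : H →L[ℂ] H) v) atTop (𝓝 0) := by
  have hD0 : 0 ≤ 1 - Q := sub_nonneg.2 h1
  have hD1 : 1 - Q ≤ 1 := sub_le_self _ h0
  have hDn : ∀ n w, ‖((1 - Q) ^ n : H →L[ℂ] H) w‖ ≤ ‖w‖ := fun n w => by
    have h2 : ‖(1 - Q) ^ n‖ ≤ 1 := by
      have h3 := (CStarAlgebra.norm_le_one_iff_of_nonneg _ hD0).2 hD1
      cases n with
      | zero => exact (pow_zero (1 - Q)).symm ▸ ContinuousLinearMap.norm_id_le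
      | succ n => exact (norm_pow_le' _ n.succ_pos).trans (pow_le_one₀ (norm_nonneg _) h3)
    simpa only [one_mul] using ((1 - Q) ^ n).le_of_opNorm_le h2 w
  have hsucc : ∀ n w, ((1 - Q) ^ (n + 1) : H →L[ℂ] H) w =
      (1 - Q) (((1 - Q) ^ n : H →L[ℂ] H) w) := fun n w => by
    rw [pow_succ', mul_apply_eq_comp]
  -- On the range of Q the squared norm is at most the drop from n to n + 1 of the convergent
  -- decreasing sequence ‖(1 - Q)^n z‖². Density and contractivity then give every v.
  have hrange : ∀ z, Tendsto (fun n => ((1 - Q) ^ n : H →L[ℂ] H) (Q z)) atTop (𝓝 0) := fun z => by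
    have hanti : Antitone fun n => ‖((1 - Q) ^ n : H →L[ℂ] H) z‖ ^ 2 :=
        antitone_nat_of_succ_le fun n => by
          have := hDn 1 (((1 - Q) ^ n : H →L[ℂ] H) z)
          rw [pow_one, ← hsucc] at this
          gcongr
    have hconv := tendsto_atTop_ciInf hanti ⟨0, by rintro _ ⟨n, rfl⟩; positivity⟩
    have hdiff := hconv.sub (hconv.comp (tendsto_add_atTop_nat 1))
    rw [sub_self] at hdiff
    have hsq : Tendsto (fun n => ‖((1 - Q) ^ n : H →L[ℂ] H) (Q z)‖ ^ 2) atTop (𝓝 0) := by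
      refine squeeze_zero (fun n => sq_nonneg _) (fun n => ?_) hdiff
      have h4 : ((1 - Q) ^ n : H →L[ℂ] H) (Q z) =
          ((1 - Q) ^ n : H →L[ℂ] H) z - (1 - Q) (((1 - Q) ^ n : H →L[ℂ] H) z) := by
        have hc : Commute ((1 - Q) ^ n : H →L[ℂ] H) Q :=
          (((Commute.one_left Q).sub_left (Commute.refl Q)).pow_left n)
        rw [← mul_apply_eq_comp, hc.eq]
        simp
      rw [h4, Function.comp_apply, hsucc]
      exact norm_sub_apply_sq_le hD0 hD1 _
    rw [tendsto_zero_iff_norm_tendsto_zero]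
    have := (Real.continuous_sqrt.tendsto 0).comp hsq
    simpa only [Function.comp_def, Real.sqrt_sq (norm_nonneg _), Real.sqrt_zero] using this
  rw [Metric.tendsto_atTop]
  intro ε hε
  obtain ⟨z, hz⟩ := (denseRange_of_injective_of_nonneg h0 hinj).exists_dist_lt v (half_pos hε)
  obtain ⟨N, hN⟩ := Metric.tendsto_atTop.1 (hrange z) (ε / 2) (half_pos hε)
  refine ⟨N, fun n hn => ?_⟩
  have h5 := hN n hn
  have h6 := hDn n (v - Q z)
  rw [dist_eq_norm] at hz
  rw [dist_zero_right] at h5 ⊢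
  rw [map_sub] at h6
  calc ‖((1 - Q) ^ n : H →L[ℂ] H) v‖
      ≤ ‖((1 - Q) ^ n : H →L[ℂ] H) v - ((1 - Q) ^ n : H →L[ℂ] H) (Q z)‖ +
          ‖((1 - Q) ^ n : H →L[ℂ] H) (Q z)‖ := by
        simpa using norm_add_le (((1 - Q) ^ n : H →L[ℂ] H) v - ((1 - Q) ^ n : H →L[ℂ] H) (Q z))
          (((1 - Q) ^ n : H →L[ℂ] H) (Q z))
    _ < ε := by linarith

theorem mul_one_sub_pow_nonneg {Q : H →L[ℂ] H} (h0 : 0 ≤ Q) (h1 : Q ≤ 1) (n : ℕ) :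
    0 ≤ Q * (1 - Q) ^ n :=
  Commute.mul_nonneg h0 (CStarAlgebra.pow_nonneg (sub_nonneg.2 h1) n)
    (((Commute.one_right Q).sub_right (Commute.refl Q)).pow_right n)

theorem mul_one_sub_pow_le {Q : H →L[ℂ] H} (h0 : 0 ≤ Q) (h1 : Q ≤ 1) (n : ℕ) :
    Q * (1 - Q) ^ n ≤ Q := by
  induction n with
  | zero => simp
  | succ n ih =>
    refine le_trans ?_ ih
    rw [← sub_nonneg]
    have h2 : Q * (1 - Q) ^ n - Q * (1 - Q) ^ (n + 1) = (Q * (1 - Q) ^ n) * Q := by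
      rw [pow_succ]; noncomm_ring
    have hc : Commute (Q * (1 - Q) ^ n) Q := (Commute.refl Q).mul_left
      (((Commute.one_left Q).sub_left (Commute.refl Q)).pow_left n)
    exact h2 ▸ hc.mul_nonneg (mul_one_sub_pow_nonneg h0 h1 n) h0

/-- The sum telescopes, with a remainder that vanishes in the limit because Q is injective.
Nonnegative terms with bounded partial sums give unconditional summability. -/
theorem hasSum_inner_mul_one_sub_pow {Q : H →L[ℂ] H} (h0 : 0 ≤ Q) (h1 : Q ≤ 1)
    (hinj : Function.Injective Q) (v : H) :
    HasSum (fun n => ⟪v, (Q * (1 - Q) ^ (n + 1) : H →L[ℂ] H) v⟫_ℂ) ⟪v, (1 - Q) v⟫_ℂ := by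
  have hpart : ∀ N, ∑ n ∈ Finset.range N, ⟪v, (Q * (1 - Q) ^ (n + 1) : H →L[ℂ] H) v⟫_ℂ =
      ⟪v, (1 - Q) v⟫_ℂ - ⟪v, ((1 - Q) ^ (N + 1) : H →L[ℂ] H) v⟫_ℂ := fun N => by
    have hterm : ∀ n, ⟪v, (Q * (1 - Q) ^ (n + 1) : H →L[ℂ] H) v⟫_ℂ =
        ⟪v, ((1 - Q) ^ (n + 1) : H →L[ℂ] H) v⟫_ℂ -
          ⟪v, ((1 - Q) ^ (n + 1 + 1) : H →L[ℂ] H) v⟫_ℂ := fun n => by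
      rw [← inner_sub_right, ← sub_apply]
      congr 2
      rw [pow_succ' _ (n + 1)]
      noncomm_ring
    rw [Finset.sum_congr rfl fun n _ => hterm n,
      Finset.sum_range_sub' (fun n => ⟪v, ((1 - Q) ^ (n + 1) : H →L[ℂ] H) v⟫_ℂ), zero_add, pow_one]
  have hnn : ∀ n, 0 ≤ ⟪v, (Q * (1 - Q) ^ (n + 1) : H →L[ℂ] H) v⟫_ℂ := fun n =>
    inner_apply_nonneg (mul_one_sub_pow_nonneg h0 h1 _) v
  have hlim : Tendsto
      (fun N => ∑ n ∈ Finset.range N, ⟪v, (Q * (1 - Q) ^ (n + 1) : H →L[ℂ] H) v⟫_ℂ) atTop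
      (𝓝 ⟪v, (1 - Q) v⟫_ℂ) := by
    simp only [hpart]
    have h2 : Tendsto (fun N => ⟪v, ((1 - Q) ^ (N + 1) : H →L[ℂ] H) v⟫_ℂ) atTop (𝓝 0) := by
      simpa using (tendsto_const_nhds (x := v)).inner (𝕜 := ℂ)
        ((tendsto_one_sub_pow_apply h0 h1 hinj v).comp (tendsto_add_atTop_nat 1))
    simpa using tendsto_const_nhds.sub h2
  refine (Summable.hasSum_iff_tendsto_nat ?_).2 hlim
  rw [← summable_norm_iff]
  refine summable_of_sum_range_le (c := (⟪v, (1 - Q) v⟫_ℂ).re) (fun n => norm_nonneg _) fun N => ?_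
  have h3 : ((∑ n ∈ Finset.range N, ‖⟪v, (Q * (1 - Q) ^ (n + 1) : H →L[ℂ] H) v⟫_ℂ‖ : ℝ) : ℂ) ≤
      ⟪v, (1 - Q) v⟫_ℂ := by
    rw [Complex.ofReal_sum, Finset.sum_congr rfl fun n _ =>
      (Complex.eq_coe_norm_of_nonneg (hnn n)).symm, hpart]
    exact sub_le_self _ (inner_apply_nonneg (CStarAlgebra.pow_nonneg (sub_nonneg.2 h1) _) v)
  simpa using (Complex.le_def.1 h3).1

end Powers

/-! ### Discrete measures with a prescribed barycenter -/

instance innerRegular_dirac {X : Type*} [TopologicalSpace X] [MeasurableSpace X] (x : X) :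
    (Measure.dirac x).InnerRegular where
  innerRegular U hU r hr := by
    by_cases hx : x ∈ U
    · refine ⟨{x}, Set.singleton_subset_iff.2 hx, isCompact_singleton, hr.trans_le ?_⟩
      exact prob_le_one.trans_eq (Measure.dirac_apply_of_mem (Set.mem_singleton x)).symm
    · rw [Measure.dirac_apply' x hU, Set.indicator_of_notMem hx] at hr
      exact absurd hr not_lt_zero

section Mixtures

variable {A : Type*} [CStarAlgebra A] [PartialOrder A]

theorem integral_smul_dirac (c : NNReal) (σ : State A) (X : A) :
    ∫ φ, φ.1 X ∂(c • Measure.dirac σ) = (c : ℂ) * σ.1 X := by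
  rw [integral_smul_nnreal_measure,
    integral_dirac' _ _ (continuous_state_apply X).stronglyMeasurable]
  rfl

variable [StarOrderedRing A]

/-- A countable sum of measures with total mass one is a regular probability measure, with the
barycenter expected. -/
theorem isBarycenter_sum {ρ : State A} {ν : ℕ → Measure (State A)} [∀ n, (ν n).InnerRegular]
    (hmass : ∑' n, ν n Set.univ = 1) (hρ : ∀ X : A, HasSum (fun n => ∫ φ, φ.1 X ∂ν n) (ρ.1 X)) :
    IsProbabilityMeasure (Measure.sum ν) ∧ (Measure.sum ν).Regular ∧
      IsBarycenter ρ (Measure.sum ν) := by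
  have hprob : IsProbabilityMeasure (Measure.sum ν) :=
    ⟨by rw [Measure.sum_apply _ MeasurableSet.univ, hmass]⟩
  exact ⟨hprob, inferInstance, fun X =>
    (hρ X).unique (hasSum_integral_measure (integrable_state_apply _ X))⟩

theorem exists_state_smul (ρ : State A) (f : A →ₚ[ℂ] ℂ) :
    ∃ (c : NNReal) (σ : State A), ∀ X, f X = (c : ℂ) * σ.1 X := by
  have hf1 : 0 ≤ f 1 := f.map_nonneg zero_le_one
  by_cases h0 : f 1 = 0
  -- Here f vanishes, so any state will do; ρ only witnesses that one exists.
  · refine ⟨0, ρ, fun X => ?_⟩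
    have h := linearMap_eq_of_star_mul_self f.toLinearMap 0 fun a => by
      have := f.norm_apply_le_of_nonneg (star a * a) (star_mul_self_nonneg a)
      rw [h0, norm_zero, zero_mul] at this
      exact norm_le_zero_iff.1 this
    simpa using DFunLike.congr_fun h X
  · have hc : f 1 = ((‖f 1‖₊ : ℝ) : ℂ) := Complex.eq_coe_norm_of_nonneg hf1
    let F : A →L[ℂ] ℂ := (f 1)⁻¹ • ⟨f.toLinearMap, map_continuous f⟩
    refine ⟨‖f 1‖₊, ⟨(F : WeakDual ℂ A), fun a ha => ?_, ?_⟩, fun X => ?_⟩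
    · exact mul_nonneg (inv_nonneg.2 hf1) (f.map_nonneg ha)
    · exact inv_mul_cancel₀ h0
    · change f X = _ * ((f 1)⁻¹ * f X)
      rw [← hc, mul_inv_cancel_left₀ h0]

/-- A state that is a countable sum of positive functionals each dominated by `ρ₂` is absolutely
continuous with respect to `ρ₂`. -/
theorem absolutelyContinuous_of_hasSum {ρ₁ ρ₂ : State A} (f g : ℕ → A →ₚ[ℂ] ℂ)
    (hfg : ∀ n X, f n X + g n X = ρ₂.1 X) (hf : ∀ X, HasSum (fun n => f n X) (ρ₁.1 X)) :
    AbsolutelyContinuous ρ₁ ρ₂ := by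
  choose c σ hσ using fun n => exists_state_smul ρ₁ (f n)
  choose e τ hτ using fun n => exists_state_smul ρ₁ (g n)
  have hce : ∀ n, c n + e n = 1 := fun n => by
    have := hfg n 1
    rw [hσ, hτ, (σ n).2.2, (τ n).2.2, ρ₂.2.2, mul_one, mul_one] at this
    exact_mod_cast this
  have hc : HasSum c 1 := by
    have := hf 1
    simp only [hσ, (σ _).2.2, ρ₁.2.2, mul_one] at this
    exact NNReal.hasSum_coe.1 (Complex.reCLM.hasSum this)
  have hw : HasSum (fun n : ℕ => (1 / 2 : NNReal) / 2 ^ n) 1 := by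
    have := hasSum_geometric_two' 1
    rw [← NNReal.hasSum_coe]
    simpa using this
  set w : ℕ → NNReal := fun n => (1 / 2 : NNReal) / 2 ^ n with hwdef
  -- Each ν n has barycenter ρ₂ and charges σ n wherever c n ≠ 0. Mixing all of them with weights
  -- 2^{-(n+1)}, none of them zero, dominates every atom of μ₁.
  let ν : ℕ → Measure (State A) := fun n => c n • Measure.dirac (σ n) + e n • Measure.dirac (τ n)
  have hν : ∀ n X, ∫ φ : State A, φ.1 X ∂ν n = ρ₂.1 X := fun n X => by
    rw [integral_add_measure (integrable_state_apply _ X) (integrable_state_apply _ X),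
      integral_smul_dirac, integral_smul_dirac, ← hσ, ← hτ, hfg]
  have hνmass : ∀ n, ν n Set.univ = 1 := fun n => by
    simp only [ν, Measure.add_apply, Measure.smul_apply, measure_univ]
    simp [ENNReal.smul_def, ← ENNReal.coe_add, hce]
  obtain ⟨hp₁, hr₁, hb₁⟩ := isBarycenter_sum (ρ := ρ₁) (ν := fun n => c n • Measure.dirac (σ n))
    (by
      simp only [Measure.smul_apply, measure_univ, ENNReal.smul_def, smul_eq_mul, mul_one]
      exact_mod_cast (ENNReal.hasSum_coe.2 hc).tsum_eq)
    (fun X => by simpa only [integral_smul_dirac, ← hσ] using hf X)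
  obtain ⟨hp₂, hr₂, hb₂⟩ := isBarycenter_sum (ρ := ρ₂) (ν := fun n => w n • ν n)
    (by
      simp only [Measure.smul_apply, hνmass, ENNReal.smul_def, smul_eq_mul, mul_one]
      exact_mod_cast (ENNReal.hasSum_coe.2 hw).tsum_eq)
    (fun X => by
      simp only [integral_smul_nnreal_measure, hν]
      simpa using hw.smul_const (ρ₂.1 X))
  refine ⟨_, _, hp₁, hr₁, hp₂, hr₂, hb₁, hb₂, Measure.absolutelyContinuous_sum_left fun n =>
    Measure.absolutelyContinuous_sum_right n ?_⟩
  have hwn : (w n : ENNReal) ≠ 0 := by simp [hwdef]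
  refine Measure.AbsolutelyContinuous.mk fun s _ hs => ?_
  have h1 : ν n s = 0 := by
    rw [Measure.smul_apply, ENNReal.smul_def, smul_eq_mul, mul_eq_zero] at hs
    exact hs.resolve_left hwn
  exact le_antisymm (le_self_add.trans h1.le) zero_le

end Mixtures

/-! ### From almost domination to measures -/

section Decomposition

variable {A : Type*} [CStarAlgebra A] [PartialOrder A] [StarOrderedRing A]

theorem inner_gnsClass_one_apply_star_mul (f : A →ₚ[ℂ] ℂ) {R : f.GNS →L[ℂ] f.GNS}
    (hcomm : ∀ X, Commute (f.gnsStarAlgHom X) R) (a b : A) :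
    ⟪gnsClass f 1, R (gnsClass f (star a * b))⟫_ℂ = ⟪gnsClass f a, R (gnsClass f b)⟫_ℂ := by
  have h1 : R (f.gnsStarAlgHom (star a) (gnsClass f b)) =
      f.gnsStarAlgHom (star a) (R (gnsClass f b)) :=
    DFunLike.congr_fun (hcomm (star a)).symm.eq _
  rw [← gnsStarAlgHom_gnsClass, h1, map_star, ContinuousLinearMap.star_eq_adjoint,
    ContinuousLinearMap.adjoint_inner_right, gnsStarAlgHom_gnsClass, mul_one]

/-- The positive functional `X ↦ ⟨ξ, R π(X) ξ⟩` attached to a positive operator `R` commuting with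
the GNS representation. -/
noncomputable def commutantFunctional (f : A →ₚ[ℂ] ℂ) (R : f.GNS →L[ℂ] f.GNS) (hR : 0 ≤ R)
    (hcomm : ∀ X, Commute (f.gnsStarAlgHom X) R) : A →ₚ[ℂ] ℂ :=
  PositiveLinearMap.mk₀
    ((innerSL ℂ (gnsClass f 1)).toLinearMap ∘ₗ R.toLinearMap ∘ₗ gnsClass f) fun a ha => by
      obtain ⟨b, rfl⟩ := CStarAlgebra.nonneg_iff_eq_star_mul_self.1 ha
      refine (inner_apply_nonneg hR (gnsClass f b)).trans_eq ?_
      exact (inner_gnsClass_one_apply_star_mul f hcomm b b).symm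

theorem commutantFunctional_apply (f : A →ₚ[ℂ] ℂ) (R : f.GNS →L[ℂ] f.GNS) (hR : 0 ≤ R)
    (hcomm : ∀ X, Commute (f.gnsStarAlgHom X) R) (X : A) :
    commutantFunctional f R hR hcomm X = ⟪gnsClass f 1, R (gnsClass f X)⟫_ℂ := rfl

/-- The operators Q (1 - Q)^(n+1) lie between 0 and Q, commute with the representation and sum to 1
- Q; their functionals decompose ρ₁. The exponent starts at 1 because the series from 0 would sum to
1, that is, to ρ₁ + ρ₂. -/
theorem AlmostDominated.absolutelyContinuous {ρ₁ ρ₂ : State A} (h : AlmostDominated ρ₁ ρ₂) :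
    AbsolutelyContinuous ρ₁ ρ₂ := by
  obtain ⟨V, hV, hVnorm⟩ := exists_gnsComparison_right ρ₁ ρ₂
  have hVinj := h.injective_comparison hV
  set Q := V.adjoint ∘L V with hQ
  have hQinner : ∀ x y, ⟪x, Q y⟫_ℂ = ⟪V x, V y⟫_ℂ := fun x y =>
    ContinuousLinearMap.adjoint_inner_right V x (V y)
  have h0 : 0 ≤ Q := (ContinuousLinearMap.nonneg_iff_isPositive _).2 V.isPositive_adjoint_comp_self
  have h1 : Q ≤ 1 := by
    have := comp_adjoint_le_one (V := V.adjoint) (by rwa [LinearIsometryEquiv.norm_map])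
    rwa [ContinuousLinearMap.adjoint_adjoint] at this
  have hinj : Function.Injective Q := by
    refine (injective_iff_map_eq_zero Q).2 fun x hx => hVinj ?_
    have := hQinner x x
    rw [hx, inner_zero_right] at this
    rw [map_zero, ← inner_self_eq_zero (𝕜 := ℂ), ← this]
  have hπ : ∀ X, Commute ((stateSum ρ₁ ρ₂).gnsStarAlgHom X) Q := fun X => by
    change (stateSum ρ₁ ρ₂).gnsStarAlgHom X ∘L (V.adjoint ∘L V) =
      (V.adjoint ∘L V) ∘L (stateSum ρ₁ ρ₂).gnsStarAlgHom X
    rw [ContinuousLinearMap.comp_assoc, gns_comparison_comp hV,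
      ← ContinuousLinearMap.comp_assoc, ← ContinuousLinearMap.comp_assoc,
      adjoint_comparison_comp hV]
  have hπn : ∀ n X, Commute ((stateSum ρ₁ ρ₂).gnsStarAlgHom X) (Q * (1 - Q) ^ n) := fun n X =>
    (hπ X).mul_right (((Commute.one_right _).sub_right (hπ X)).pow_right n)
  have hρ₂ : ∀ X, ⟪gnsClass (stateSum ρ₁ ρ₂) 1, Q (gnsClass _ X)⟫_ℂ = ρ₂.1 X := fun X => by
    rw [hQinner, hV, hV, inner_gnsClass, star_one, one_mul, toPositive_apply]
  have hρ₁ : ∀ X, ⟪gnsClass (stateSum ρ₁ ρ₂) 1, (1 - Q) (gnsClass _ X)⟫_ℂ = ρ₁.1 X := fun X => by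
    rw [sub_apply, inner_sub_right, hρ₂, one_apply_eq_self, inner_gnsClass, star_one, one_mul,
      stateSum_apply, add_sub_cancel_right]
  refine absolutelyContinuous_of_hasSum
    (fun n => commutantFunctional _ (Q * (1 - Q) ^ (n + 1)) (mul_one_sub_pow_nonneg h0 h1 _)
      (hπn (n + 1)))
    (fun n => commutantFunctional _ (Q - Q * (1 - Q) ^ (n + 1))
      (sub_nonneg.2 (mul_one_sub_pow_le h0 h1 _)) fun X => (hπ X).sub_right (hπn (n + 1) X))
    (fun n X => ?_) fun X => ?_
  · rw [commutantFunctional_apply, commutantFunctional_apply, sub_apply, inner_sub_right, hρ₂,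
      add_sub_cancel]
  · simp only [commutantFunctional_apply]
    induction (CStarAlgebra.span_nonneg (A := A)).symm ▸ Submodule.mem_top (x := X) using
      Submodule.span_induction with
    | mem a ha =>
      obtain ⟨b, rfl⟩ := CStarAlgebra.nonneg_iff_eq_star_mul_self.1 ha
      rw [← hρ₁, inner_gnsClass_one_apply_star_mul _ fun X =>
        (Commute.one_right _).sub_right (hπ X)]
      simp only [fun n => inner_gnsClass_one_apply_star_mul _ (hπn n)]
      exact hasSum_inner_mul_one_sub_pow h0 h1 hinj _
    | zero => simpa only [map_zero, inner_zero_right] using hasSum_zero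
    | add a b _ _ ha hb => simpa only [map_add, inner_add_right] using ha.add hb
    | smul c a _ ha =>
      simpa only [map_smul, inner_smul_right, smul_eq_mul] using ha.mul_left c

end Decomposition

end CStarState

theorem mainTheorem4 {A : Type*} [CStarAlgebra A] [PartialOrder A] [StarOrderedRing A]
    (ρ₁ ρ₂ : CStarState.State A) :
    List.TFAE [
      CStarState.AbsolutelyContinuous ρ₁ ρ₂,
      CStarState.AlmostDominated ρ₁ ρ₂,
      CStarState.HasAffiliatedDensity ρ₁ ρ₂] := by
  tfae_have 1 → 2 := CStarState.AbsolutelyContinuous.almostDominated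
  tfae_have 2 → 3 := CStarState.AlmostDominated.hasAffiliatedDensity
  tfae_have 3 → 2 := CStarState.HasAffiliatedDensity.almostDominated
  tfae_have 2 → 1 := CStarState.AlmostDominated.absolutelyContinuous
  tfae_finish
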